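/- Let $p\ge 5$ be prime. For an integer $k\ge 0$ let $M_k$ denote the set of modular forms of weight $k$ on $\mathrm{SL}_2(\mathbb Z)$ whose Fourier coefficients lie in the ring $\mathbb Z_{(p)}$ of $p$-integral rational numbers, identified with their $q$-expansions in $\mathbb Z_{(p)}[[q]]$; congruences between elements of $\mathbb Z_{(p)}[[q]]$ are meant coefficient-wise. For even $k\ge 2$ define $G_k$ and $E_k$ by $$G_k=-\frac{B_k}{2k}E_k=-\frac{B_k}{2k}+\sum_{n\ge1}\sigma_{k-1}(n)q^n ,$$ where $B_k$ is the Bernoulli number and $\sigma_{k-1}(n)$ is the sum of the $(k-1)$-st powers of the positive divisors of $n$. For $m\ge1$ and $f\in\mathbb Z_{(p)}[[q]]$ let $$\tilde\omega_{p^m}(f)=\inf\{k : f\equiv E_{p-1}^{\,n}\,g \pmod{p^m}\text{ for some } n\ge0\text{ and some } g\in M_k\}$$ be the factor filtration of $f$ modulo $p^m$ (with $\inf\emptyset=\infty$). Let $k\ge4$ be an even integer, written as $k=\alpha(p-1)+k_0$ with integers $\alpha\ge0$ and $2\le k_0\le p-3$. Then $G_k\in\mathbb Z_{(p)}[[q]]$,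 and the following hold. 1. If $k_0\ge4$, then $$\tilde\omega_{p^3}(G_k)\le\begin{cases}(p-1)+k_0,&\text{if }\alpha\equiv0,1\pmod p;\\ 2(p-1)+k_0,&\text{otherwise.}\end{cases}$$ 2. If $k_0=2$, then $$\tilde\omega_{p^3}(G_k)\le\begin{cases}(p-1)+2,&\text{if }\alpha\equiv1\pmod p;\\ 2(p-1)+2,&\text{if }\alpha\equiv2\pmod p;\\ 3(p-1)+2,&\text{otherwise.}\end{cases}$$ -/

import Mathlib

open scoped MatrixGroups ArithmeticFunction.sigma

noncomputable section

namespace EisensteinFiltration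

/-- A rational number is `p`-integral, i.e. lies in `ℤ_(p)`, when `p` does not divide its
(reduced) denominator. -/
def PIntegral (p : ℕ) (x : ℚ) : Prop := ¬ p ∣ x.den

/-- A power series with rational coefficients that lies in `ℤ_(p)⟦q⟧`. -/
def PIntegralSeries (p : ℕ) (f : PowerSeries ℚ) : Prop :=
  ∀ n : ℕ, PIntegral p (PowerSeries.coeff n f)

/-- `f ≡ g (mod p ^ m)`, coefficient-wise, for elements `f`, `g` of `ℤ_(p)⟦q⟧`
(that both series are `p`-integral is part of the assertion). -/
def CongrMod (p m : ℕ) (f g : PowerSeries ℚ) : Prop :=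
  PIntegralSeries p f ∧ PIntegralSeries p g ∧
    ∀ n : ℕ, ∃ c : ℚ, PIntegral p c ∧
      PowerSeries.coeff n f - PowerSeries.coeff n g = (p : ℚ) ^ m * c

/-- `M_k`: the `q`-expansions of the modular forms of weight `k` on `SL₂(ℤ)` whose Fourier
coefficients are `p`-integral rational numbers. -/
def M (p k : ℕ) : Set (PowerSeries ℚ) :=
  {g | PIntegralSeries p g ∧
    ∃ F : ModularForm 𝒮ℒ (k : ℤ),
      UpperHalfPlane.qExpansion 1 F = PowerSeries.map (algebraMap ℚ ℂ) g}

/-- The Eisenstein series `G_k = -B_k / (2k) + ∑_{n ≥ 1} σ_{k-1}(n) q ^ n`, for even `k ≥ 2`. -/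
def G (k : ℕ) : PowerSeries ℚ :=
  PowerSeries.mk fun n => if n = 0 then -(bernoulli k) / (2 * k) else (σ (k - 1) n : ℚ)

/-- The normalised Eisenstein series: `G_k = -B_k / (2k) * E_k` for even `k ≥ 2`, and `E_0 = 1`. -/
def E (k : ℕ) : PowerSeries ℚ :=
  if k = 0 then 1 else PowerSeries.C (-(2 * k) / bernoulli k) * G k

/-- The factor filtration of `f` modulo `p ^ m`: the infimum of the weights `k` such that
`f ≡ E_{p-1} ^ n g (mod p ^ m)` for some `n ≥ 0` and some `g ∈ M_k`. It takes values in `ℕ∞`, so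
that it is `⊤` when there is no such weight. -/
def factorFiltration (p m : ℕ) (f : PowerSeries ℚ) : ℕ∞ :=
  ⨅ (k : ℕ) (_ : ∃ n : ℕ, ∃ g ∈ M p k, CongrMod p m f (E (p - 1) ^ n * g)), (k : ℕ∞)

end EisensteinFiltration

end

/-! Fix the residue class of the weight modulo `p - 1` and let `g a` be the Eisenstein series of
weight `κ + 1 + a(p - 1)`. Once the divisors divisible by `p` are removed, Fermat (for the higher
coefficients) and Kummer (for the constant term) show that `g a` is, modulo `p ^ 3`, a polynomial of
degree at most two in `p * a` (`quadMod_G`). The removed part is `p ^ (weight - 1)` times a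
`p`-integral series, hence invisible modulo `p ^ 3` when the weight is at least 4.

Since `e = E_{p-1}` has the form `1 + p x`, the powers `e ^ (-a)` are quadratic in the same sense,
and so is `g a * e ^ (-a)`. Interpolation at 0, 1, 2 writes `g a` as `e ^ (a - 2)` times a
combination of `e ^ 2 g 0`, `e g 1`, `g 2`, a form of weight `2(p - 1) + κ + 1`. The second
difference is divisible by `p ^ 2`, so if `p ∣ a(a - 1)` linear interpolation suffices and one
factor of `e` is saved (`factorFiltration_G_le`). Negative powers of `e` do no harm, because `e ^ (p
^ 2) ≡ 1` modulo `p ^ 3`.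

For `k₀ = 2` the series `G_2` is not modular. Starting the family at weight `p + 1` instead costs
one more `p - 1`. When `α ≡ 1` this cost is avoided: interpolate linearly between `G_2(q) - p G_2(q
^ p)` and `G_{p+1}`. The first has coefficient `1 - α`, divisible by `p`, so it matters only modulo
`p ^ 2`, where `E_{p-1}` times it is a form of weight `p + 1` built from the Serre derivative of
`E_{p-1}` (`exists_isModular_mul_G_two`). -/

noncomputable section

namespace EisensteinFiltration

/-! ### Modular forms through their `q`-expansions, and the Serre derivative. -/

section ModularForms

open UpperHalfPlane ModularForm Function Derivative
open scoped Manifold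

local notation "𝕢" => Function.Periodic.qParam

lemma periodic_of_hasSum_qParam {f : ℍ → ℂ} {c : ℕ → ℂ}
    (hf : ∀ τ : ℍ, HasSum (fun m ↦ c m • 𝕢 (1 : ℝ) τ ^ m) (f τ)) :
    Periodic (f ∘ ofComplex) (1 : ℝ) := by
  intro z
  by_cases hz : 0 < z.im
  · have hz' : 0 < (z + (1 : ℝ)).im := by simpa using hz
    simp only [comp_apply, ofComplex_apply_of_im_pos hz, ofComplex_apply_of_im_pos hz']
    have h1 := hf ⟨z, hz⟩
    have h2 := hf ⟨z + (1 : ℝ), hz'⟩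
    have : 𝕢 (1 : ℝ) (z + (1 : ℝ)) = 𝕢 (1 : ℝ) z := by
      simp [Periodic.qParam, mul_add, Complex.exp_add]
    simp only [this] at h2
    exact h2.unique h1
  · have hz' : ¬ 0 < (z + (1 : ℝ)).im := by simpa using hz
    simp only [comp_apply, ofComplex_apply_of_im_nonpos (not_lt.mp hz),
      ofComplex_apply_of_im_nonpos (not_lt.mp hz')]

lemma analyticAt_cuspFunction_of_hasSum_qParam {f : ℍ → ℂ} {c : ℕ → ℂ} (hd : MDiff f)
    (hf : ∀ τ : ℍ, HasSum (fun m ↦ c m • 𝕢 (1 : ℝ) τ ^ m) (f τ)) :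
    AnalyticAt ℂ (cuspFunction 1 f) 0 :=
  analyticAt_cuspFunction_zero one_pos (periodic_of_hasSum_qParam hf) hd
    (isBoundedAtImInfty_of_hasSum_qExpansion one_pos hf)

/-- Uniqueness of the Taylor series of the cusp function at 0. Modularity is not assumed, so this
covers `E2` and the derivative of a form. -/
lemma qExpansion_eq_mk_of_hasSum_qParam {f : ℍ → ℂ} {c : ℕ → ℂ} (hd : MDiff f)
    (hf : ∀ τ : ℍ, HasSum (fun m ↦ c m • 𝕢 (1 : ℝ) τ ^ m) (f τ)) :
    qExpansion 1 f = PowerSeries.mk c := by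
  ext m
  have ha := analyticAt_cuspFunction_of_hasSum_qParam hd hf
  have h1 := (hasFPowerSeriesOnBall_cuspFunction one_pos ha hf).hasFPowerSeriesAt
  have h2 : HasFPowerSeriesAt (cuspFunction 1 f)
      (.ofScalars ℂ fun m => (qExpansion 1 f).coeff m) 0 := by
    simpa [qExpansion_coeff, div_eq_mul_inv, mul_comm]
      using ha.hasFPowerSeriesAt
  simpa using congr_arg (FormalMultilinearSeries.coeff · m)
    (h2.eq_formalMultilinearSeries h1)

/-- The derivation `q d/dq` on power series. -/
def qDeriv {A : Type*} [Semiring A] (f : PowerSeries A) : PowerSeries A :=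
  PowerSeries.mk fun n => n * PowerSeries.coeff n f

@[simp] lemma coeff_qDeriv {A : Type*} [Semiring A] (f : PowerSeries A) (n : ℕ) :
    PowerSeries.coeff n (qDeriv f) = n * PowerSeries.coeff n f := by
  simp [qDeriv]

/-- Write `f = φ(q)` with `φ` the cusp function; by the chain rule `(2πi)⁻¹ d/dτ` becomes `q d/dq`,
and `φ` may be differentiated termwise on the unit disc. -/
lemma hasSum_normalizedDerivOfComplex {f : ℍ → ℂ} (hper : Periodic (f ∘ ofComplex) (1 : ℝ))
    (hd : MDiff f) (hb : IsBoundedAtImInfty f) (τ : ℍ) :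
    HasSum (fun m ↦ (qDeriv (qExpansion 1 f)).coeff m • 𝕢 (1 : ℝ) τ ^ m)
      (normalizedDerivOfComplex f τ) := by
  set φ := cuspFunction 1 f
  have hφ : DifferentiableOn ℂ φ (Metric.ball 0 1) :=
    differentiableOn_cuspFunction_ball one_pos hper hd hb
  set q := 𝕢 (1 : ℝ) τ with hq
  have hq1 : ‖q‖ < 1 := Periodic.norm_qParam_lt_one one_pos τ.im_pos
  have hqmem : q ∈ Metric.ball (0 : ℂ) 1 := by simpa using hq1
  have h1 : HasSum (fun n : ℕ ↦ ((n + 1 : ℕ) : ℂ) * (qExpansion 1 f).coeff (n + 1) * q ^ n)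
      (deriv φ q) := by
    have := Complex.hasSum_taylorSeries_on_ball (hφ.deriv Metric.isOpen_ball) hqmem
    convert! this using 2 with n
    simp only [qExpansion_coeff, sub_zero, smul_eq_mul, ← iteratedDeriv_succ', Nat.factorial_succ]
    have h0 : ((n : ℂ) + 1) ≠ 0 := by exact_mod_cast n.succ_ne_zero
    have h0' : ((n.factorial : ℕ) : ℂ) ≠ 0 := by exact_mod_cast n.factorial_ne_zero
    push_cast
    field_simp
    exact mul_comm _ _
  have h2 : normalizedDerivOfComplex f τ = q * deriv φ q := by
    have e : f ∘ ofComplex =ᶠ[nhds (τ : ℂ)] fun z => φ (𝕢 (1 : ℝ) z) := by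
      filter_upwards [isOpen_upperHalfPlaneSet.mem_nhds τ.im_pos] with z hz
      have := eq_cuspFunction (f := f) ⟨z, hz⟩ one_ne_zero hper
      simp only [comp_apply, ofComplex_apply_of_im_pos hz]
      exact this.symm
    have hq' : HasDerivAt (𝕢 (1 : ℝ)) (2 * Real.pi * Complex.I * q) (τ : ℂ) := by
      have : 𝕢 (1 : ℝ) = fun z => Complex.exp (2 * Real.pi * Complex.I * z) := by
        ext z; simp [Periodic.qParam]
      rw [hq, this]
      have := ((hasDerivAt_id (τ : ℂ)).const_mul (2 * Real.pi * Complex.I)).cexp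
      simpa [mul_comm] using this
    have hφ' : HasDerivAt φ (deriv φ q) q :=
      (hφ.differentiableAt (Metric.isOpen_ball.mem_nhds hqmem)).hasDerivAt
    rw [normalizedDerivOfComplex, e.deriv_eq]
    erw [(hφ'.comp (τ : ℂ) hq').deriv]
    have : (2 * Real.pi * Complex.I) ≠ 0 := by simp [Real.pi_ne_zero]
    field_simp
  rw [h2, ← hasSum_nat_add_iff' 1]
  simp only [Finset.range_one, Finset.sum_singleton, coeff_qDeriv, Nat.cast_zero, zero_mul,
    zero_smul, sub_zero]
  convert! h1.mul_left q using 2 with n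
  simp only [smul_eq_mul]
  ring

/-- A power series over `ℚ` that is the `q`-expansion of a modular form of weight `k` and
level one. -/
def IsModular (k : ℕ) (g : PowerSeries ℚ) : Prop :=
  ∃ F : ModularForm 𝒮ℒ (k : ℤ), qExpansion 1 F = PowerSeries.map (algebraMap ℚ ℂ) g

lemma IsModular.add {k : ℕ} {f g : PowerSeries ℚ} (hf : IsModular k f) (hg : IsModular k g) :
    IsModular k (f + g) := by
  obtain ⟨F, hF⟩ := hf
  obtain ⟨H, hH⟩ := hg
  refine ⟨F + H, ?_⟩
  rw [FunLike.coe_add, ModularForm.qExpansion_add one_pos one_mem_strictPeriods_SL, hF, hH,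
    map_add]

lemma IsModular.C_mul {k : ℕ} {f : PowerSeries ℚ} (r : ℚ) (hf : IsModular k f) :
    IsModular k (PowerSeries.C r * f) := by
  obtain ⟨F, hF⟩ := hf
  refine ⟨(r : ℂ) • F, ?_⟩
  have : ⇑((r : ℂ) • F) = (r : ℂ) • ⇑F := rfl
  rw [this, ModularForm.qExpansion_smul one_pos one_mem_strictPeriods_SL, hF, map_mul,
    PowerSeries.map_C, PowerSeries.smul_eq_C_mul]
  rfl

lemma IsModular.mul {k l : ℕ} {f g : PowerSeries ℚ} (hf : IsModular k f) (hg : IsModular l g) :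
    IsModular (k + l) (f * g) := by
  obtain ⟨F, hF⟩ := hf
  obtain ⟨H, hH⟩ := hg
  refine ⟨ModularForm.mcast (by push_cast; ring) (F.mul H), ?_⟩
  rw [ModularForm.qExpansion_mcast _ rfl, ModularForm.qExpansion_mul one_pos
    one_mem_strictPeriods_SL, hF, hH, map_mul]

/-- Euler's formula for `ζ(2m)`, together with the non-vanishing of `ζ` on `Re s ≥ 1`. -/
lemma bernoulli_ne_zero_of_even {k : ℕ} (hk : Even k) (hk4 : 4 ≤ k) : bernoulli k ≠ 0 := by
  intro h
  obtain ⟨m, rfl⟩ := hk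
  have h2 := riemannZeta_two_mul_nat (show m ≠ 0 by omega)
  rw [show 2 * m = m + m by ring, h] at h2
  have h3 : riemannZeta (2 * (m : ℂ)) ≠ 0 := by
    apply riemannZeta_ne_zero_of_one_le_re
    simp
    have : (2 : ℝ) ≤ m := by exact_mod_cast (by omega : 2 ≤ m)
    linarith
  simp at h2
  exact h3 h2

lemma isModular_G {k : ℕ} (hk : Even k) (hk4 : 4 ≤ k) : IsModular k (G k) := by
  have h3 : 3 ≤ k := by omega
  have hB := bernoulli_ne_zero_of_even hk hk4
  refine ⟨((-(bernoulli k) / (2 * k) : ℚ) : ℂ) • ModularForm.E h3, ?_⟩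
  have : ⇑(((-(bernoulli k) / (2 * k) : ℚ) : ℂ) • ModularForm.E h3) =
    ((-(bernoulli k) / (2 * k) : ℚ) : ℂ) • ⇑(ModularForm.E h3) := rfl
  rw [this, ModularForm.qExpansion_smul one_pos one_mem_strictPeriods_SL]
  ext n
  rw [PowerSeries.coeff_smul, EisensteinSeries.E_qExpansion_coeff h3 hk, PowerSeries.coeff_map, G,
    PowerSeries.coeff_mk]
  split_ifs with hn
  · simp
  · have hB' : (bernoulli k : ℂ) ≠ 0 := by exact_mod_cast hB
    have hk' : (k : ℂ) ≠ 0 := by exact_mod_cast (by omega : k ≠ 0)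
    simp
    field_simp

lemma isModular_E {k : ℕ} (hk : Even k) (hk4 : 4 ≤ k) : IsModular k (E k) := by
  rw [E, if_neg (by omega)]
  exact (isModular_G hk hk4).C_mul _

/-- The Serre derivative on `q`-expansions. -/
lemma IsModular.serreDerivative {k : ℕ} {f : PowerSeries ℚ} (hf : IsModular k f) :
    IsModular (k + 2) (qDeriv f + PowerSeries.C (2 * k : ℚ) * (G 2 * f)) := by
  obtain ⟨F, hF⟩ := hf
  have hper : Periodic (F ∘ ofComplex) (1 : ℝ) :=
    SlashInvariantFormClass.periodic_comp_ofComplex F one_mem_strictPeriods_SL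
  have hd : MDiff (F : ℍ → ℂ) := F.holo'
  have hb : IsBoundedAtImInfty (F : ℍ → ℂ) := ModularFormClass.bdd_at_infty F
  have hD := hasSum_normalizedDerivOfComplex hper hd hb
  have hDd := normalizedDerivOfComplex_mdifferentiable hd
  have hDa := analyticAt_cuspFunction_of_hasSum_qParam hDd hD
  have hE : ∀ τ : ℍ, HasSum (fun m : ℕ ↦ (if m = 0 then 1 else -24 * σ 1 m : ℂ) •
      𝕢 (1 : ℝ) τ ^ m) (EisensteinSeries.E2 τ) := fun τ => by
    simpa only [Function.Periodic.qParam, Complex.ofReal_one, div_one] using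
      EisensteinSeries.hasSum_qExpansion_E2 (z := τ)
  have hEd := E2_mdifferentiable
  have hEa := analyticAt_cuspFunction_of_hasSum_qParam hEd hE
  have hFa : AnalyticAt ℂ (cuspFunction 1 F) 0 :=
    ModularFormClass.analyticAt_cuspFunction_zero F one_pos one_mem_strictPeriods_SL
  have hEFa : AnalyticAt ℂ (cuspFunction 1 (EisensteinSeries.E2 * F)) 0 := by
    rw [cuspFunction_mul hEa.continuousAt hFa.continuousAt]
    exact hEa.mul hFa
  have heq : Derivative.serreDerivative (k : ℂ) F =
      normalizedDerivOfComplex F + (-(k * 12⁻¹) : ℂ) • (EisensteinSeries.E2 * F) := by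
    ext z
    simp
    ring
  have hsa : AnalyticAt ℂ (cuspFunction 1 ((-(k * 12⁻¹) : ℂ) • (EisensteinSeries.E2 * F))) 0 := by
    rw [cuspFunction_smul hEFa.continuousAt]
    exact hEFa.const_smul
  -- Since `G_2 = -E_2 / 24`, the Serre correction `-(k / 12) E_2 f` is `2k G_2 f`.
  have hq : qExpansion 1 (Derivative.serreDerivative (k : ℂ) F) =
      PowerSeries.map (algebraMap ℚ ℂ) (qDeriv f + PowerSeries.C (2 * k : ℚ) * (G 2 * f)) := by
    rw [heq, qExpansion_add hDa hsa, qExpansion_smul hEFa, qExpansion_mul hEa hFa,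
      qExpansion_eq_mk_of_hasSum_qParam hDd hD, qExpansion_eq_mk_of_hasSum_qParam hEd hE, hF,
      map_add, map_mul _ (PowerSeries.C _), map_mul _ (G 2), PowerSeries.map_C, PowerSeries.smul_eq_C_mul, ← mul_assoc,
      ← mul_assoc]
    congr 1
    · ext n
      simp
    · congr 1
      ext n
      rw [PowerSeries.coeff_C_mul, PowerSeries.coeff_C_mul, PowerSeries.coeff_mk,
        PowerSeries.coeff_map, G, PowerSeries.coeff_mk]
      split_ifs with hn
      · simp [bernoulli_two]
        ring
      · simp
        ring
  have hinv : ∀ γ : SL(2, ℤ), SlashAction.map ((k + 2 : ℕ) : ℤ) γ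
      (Derivative.serreDerivative (k : ℂ) F) = Derivative.serreDerivative (k : ℂ) F := by
    intro γ
    have hγ : SlashAction.map (k : ℤ) γ (F : ℍ → ℂ) = F :=
      SlashInvariantFormClass.slash_action_eq F _ ⟨γ, rfl⟩
    have := serreDerivative_slash_invariant (k := (k : ℤ)) hd hγ
    simpa using this
  have hbdd : IsBoundedAtImInfty (Derivative.serreDerivative (k : ℂ) F) := by
    rw [heq]
    have h1 : IsBoundedAtImInfty (normalizedDerivOfComplex F) :=
      isBoundedAtImInfty_of_hasSum_qExpansion one_pos hD
    have h2 : IsBoundedAtImInfty (EisensteinSeries.E2 * ⇑F) :=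
      EisensteinSeries.isBoundedAtImInfty_E2.mul hb
    exact h1.add (h2.smul _)
  refine ⟨⟨⟨Derivative.serreDerivative (k : ℂ) F, ?_⟩, ?_, ?_⟩, hq⟩
  · rintro _ ⟨γ, rfl⟩
    exact hinv γ
  · exact serreDerivative_mdifferentiable _ hd
  · intro c hc
    -- Every cusp is `SL₂(ℤ)`-equivalent to infinity, so invariance reduces boundedness to infinity.
    rw [Subgroup.IsArithmetic.isCusp_iff_isCusp_SL2Z] at hc
    rw [OnePoint.isBoundedAt_iff_forall_SL2Z hc]
    intro γ _
    change IsBoundedAtImInfty (SlashAction.map ((k + 2 : ℕ) : ℤ) γ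
      (Derivative.serreDerivative (k : ℂ) F))
    rw [hinv γ]
    exact hbdd

end ModularForms

/-! ### The ring of `p`-integers and power series over it. -/

section PIntegers

/-- The ring `ℤ_(p)` of `p`-integral rational numbers. -/
def pInt (p : ℕ) [Fact p.Prime] : Subring ℚ := (Rat.padicValuation p).integer

variable {p : ℕ} [hp : Fact p.Prime]

lemma mem_pInt {x : ℚ} : x ∈ pInt p ↔ PIntegral p x :=
  Rat.padicValuation_le_one_iff

/-- The inclusion of `ℤ_(p)⟦q⟧` into `ℚ⟦q⟧`. -/
abbrev toQ : PowerSeries (pInt p) →+* PowerSeries ℚ := PowerSeries.map (pInt p).subtype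

lemma coeff_toQ (f : PowerSeries (pInt p)) (n : ℕ) :
    PowerSeries.coeff n (toQ f) = ((PowerSeries.coeff n f : pInt p) : ℚ) := by
  simp

lemma exists_toQ_eq {f : PowerSeries ℚ} (hf : ∀ n, PowerSeries.coeff n f ∈ pInt p) :
    ∃ g : PowerSeries (pInt p), toQ g = f :=
  ⟨PowerSeries.mk fun n => ⟨PowerSeries.coeff n f, hf n⟩, by ext n; simp⟩

lemma pIntegralSeries_toQ (f : PowerSeries (pInt p)) : PIntegralSeries p (toQ f) := fun n => by
  rw [coeff_toQ]
  exact mem_pInt.mp (PowerSeries.coeff n f).2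

lemma natCast_pow_dvd_iff {m : ℕ} {f : PowerSeries (pInt p)} :
    ((p : PowerSeries (pInt p)) ^ m ∣ f) ↔
      ∀ n, (p : pInt p) ^ m ∣ PowerSeries.coeff n f := by
  have : (p : PowerSeries (pInt p)) ^ m = PowerSeries.C ((p : pInt p) ^ m) := by simp
  rw [this]
  constructor
  · rintro ⟨g, rfl⟩ n
    rw [PowerSeries.coeff_C_mul]
    exact dvd_mul_right _ _
  · intro h
    choose c hc using h
    exact ⟨PowerSeries.mk c, by ext n; rw [PowerSeries.coeff_C_mul, PowerSeries.coeff_mk, hc]⟩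

lemma congrMod_toQ {m : ℕ} {f g : PowerSeries (pInt p)}
    (h : (p : PowerSeries (pInt p)) ^ m ∣ f - g) : CongrMod p m (toQ f) (toQ g) := by
  refine ⟨pIntegralSeries_toQ f, pIntegralSeries_toQ g, fun n => ?_⟩
  obtain ⟨c, hc⟩ := natCast_pow_dvd_iff.mp h n
  refine ⟨c, mem_pInt.mp c.2, ?_⟩
  rw [coeff_toQ, coeff_toQ]
  have := congrArg (Subtype.val) hc
  rw [map_sub] at this
  exact_mod_cast this

lemma factorFiltration_toQ_le {m n k : ℕ} {f e g : PowerSeries (pInt p)}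
    (he : toQ e = E (p - 1)) (hg : IsModular k (toQ g))
    (h : (p : PowerSeries (pInt p)) ^ m ∣ f - e ^ n * g) :
    factorFiltration p m (toQ f) ≤ (k : ℕ∞) := by
  refine iInf₂_le k ⟨n, toQ g, ⟨pIntegralSeries_toQ g, hg⟩, ?_⟩
  rw [← he, ← map_pow, ← map_mul]
  exact congrMod_toQ h

lemma IsModular.C_mul_toQ {k : ℕ} {f : PowerSeries (pInt p)} (hf : IsModular k (toQ f))
    (r : pInt p) : IsModular k (toQ (PowerSeries.C r * f)) := by
  rw [map_mul, PowerSeries.map_C]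
  exact hf.C_mul _

lemma isUnit_intCast {n : ℤ} (hn : ¬ (p : ℤ) ∣ n) : IsUnit (n : pInt p) := by
  have hn0 : (n : ℚ) ≠ 0 := by
    rintro h
    exact hn (by simp [Int.cast_eq_zero.mp h])
  have : ((n : ℚ))⁻¹ ∈ pInt p := by
    rw [mem_pInt, PIntegral, Rat.inv_intCast_den, if_neg (by exact_mod_cast hn0)]
    exact fun h => hn (Int.natCast_dvd.mpr h)
  refine IsUnit.of_mul_eq_one ⟨_, this⟩ ?_
  ext
  simp [hn0]

lemma isUnit_natCast {n : ℕ} (hn : ¬ p ∣ n) : IsUnit (n : pInt p) := by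
  simpa using isUnit_intCast (p := p) (n := n) (by simpa [Int.natCast_dvd_natCast] using hn)

lemma isUnit_one_add_mul (t : pInt p) : IsUnit (1 + (p : pInt p) * t) := by
  have hv : Rat.padicValuation p ((1 + (p : pInt p) * t : pInt p) : ℚ) = 1 := by
    have h1 : Rat.padicValuation p ((p : ℚ) * t) < 1 := by
      rw [map_mul, Rat.padicValuation_self]
      calc _ ≤ WithZero.exp (-1 : ℤ) * 1 := by gcongr; exact t.2
        _ < 1 := by rw [mul_one, ← WithZero.exp_zero]; exact WithZero.exp_lt_exp.mpr (by norm_num)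
    push_cast
    rw [Valuation.map_add_eq_of_lt_left _ (by simpa using h1), map_one]
  have hne : ((1 + (p : pInt p) * t : pInt p) : ℚ) ≠ 0 := by
    intro h
    rw [h] at hv
    simp at hv
  have : ((1 + (p : pInt p) * t : pInt p) : ℚ)⁻¹ ∈ pInt p := by
    change Rat.padicValuation p _ ≤ 1
    rw [map_inv₀, hv, inv_one]
  refine IsUnit.of_mul_eq_one ⟨_, this⟩ ?_
  ext
  exact mul_inv_cancel₀ hne

end PIntegers

/-! ### Functions that are quadratic in `π a` modulo `π ^ 3`. -/

section QuadMod

variable {A : Type*} [CommRing A]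

/-- `F` agrees on `S`, modulo `π ^ 3`, with a polynomial of degree at most two in `π * a`. -/
def QuadMod (π : A) (S : Set ℕ) (F : ℕ → A) : Prop :=
  ∃ c₀ c₁ c₂ : A, ∀ a ∈ S, π ^ 3 ∣ F a - (c₀ + (π * a) * c₁ + (π * a) ^ 2 * c₂)

variable {π : A} {S : Set ℕ} {F H : ℕ → A}

lemma QuadMod.const (c : A) : QuadMod π S fun _ => c :=
  ⟨c, 0, 0, fun a _ => by simp⟩

lemma QuadMod.congr (hF : QuadMod π S F) (h : ∀ a ∈ S, π ^ 3 ∣ H a - F a) : QuadMod π S H := by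
  obtain ⟨c₀, c₁, c₂, hc⟩ := hF
  exact ⟨c₀, c₁, c₂, fun a ha => by
    convert! dvd_add (h a ha) (hc a ha) using 1
    ring⟩

lemma QuadMod.add (hF : QuadMod π S F) (hH : QuadMod π S H) :
    QuadMod π S fun a => F a + H a := by
  obtain ⟨c₀, c₁, c₂, hc⟩ := hF
  obtain ⟨d₀, d₁, d₂, hd⟩ := hH
  exact ⟨c₀ + d₀, c₁ + d₁, c₂ + d₂, fun a ha => by
    convert! dvd_add (hc a ha) (hd a ha) using 1
    ring⟩

lemma QuadMod.mul (hF : QuadMod π S F) (hH : QuadMod π S H) :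
    QuadMod π S fun a => F a * H a := by
  obtain ⟨c₀, c₁, c₂, hc⟩ := hF
  obtain ⟨d₀, d₁, d₂, hd⟩ := hH
  refine ⟨c₀ * d₀, c₀ * d₁ + c₁ * d₀, c₀ * d₂ + c₁ * d₁ + c₂ * d₀, fun a ha => ?_⟩
  obtain ⟨x, hx⟩ := hc a ha
  obtain ⟨y, hy⟩ := hd a ha
  rw [sub_eq_iff_eq_add] at hx hy
  simp only [hx, hy]
  exact ⟨x * (π ^ 3 * y + (d₀ + (π * a) * d₁ + (π * a) ^ 2 * d₂)) +
    (c₀ + (π * a) * c₁ + (π * a) ^ 2 * c₂) * y +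
    a ^ 3 * (c₁ * d₂ + c₂ * d₁ + π * a * c₂ * d₂), by ring⟩

lemma QuadMod.sum {ι : Type*} (s : Finset ι) {F : ι → ℕ → A}
    (hF : ∀ i ∈ s, QuadMod π S (F i)) : QuadMod π S fun a => ∑ i ∈ s, F i a := by
  classical
  induction s using Finset.induction_on with
  | empty => simpa using QuadMod.const 0
  | insert i s hi ih =>
    simp only [Finset.sum_insert hi]
    exact (hF i (Finset.mem_insert_self i s)).add
      (ih fun j hj => hF j (Finset.mem_insert_of_mem hj))

/-- The binomial expansion up to second order; splitting `a(a - 1)/2` into `a ^ 2 / 2 - a / 2` gives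
the coefficients below, with `h = 1/2`. -/
lemma QuadMod.one_add_pow (h2 : IsUnit (2 : A)) (t : A) :
    QuadMod π S fun a => (1 + π * t) ^ a := by
  obtain ⟨h, hh⟩ := h2.exists_right_inv
  refine ⟨1, t - π * t ^ 2 * h, t ^ 2 * h, fun a ha => ?_⟩
  clear ha
  induction a with
  | zero => simp
  | succ a ih =>
    obtain ⟨x, hx⟩ := ih
    rw [sub_eq_iff_eq_add] at hx
    dsimp only at hx ⊢
    rw [pow_succ (1 + π * t), hx]
    refine ⟨x * (1 + π * t) + h * a * (a - 1) * t ^ 3, ?_⟩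
    push_cast
    linear_combination (-π ^ 2 * t ^ 2 * a) * hh

/-- Newton's forward difference formula is exact on quadratic polynomials and divides only by 2, so
no power of `π` is lost. -/
lemma QuadMod.interpolate (hF : QuadMod π S F) {h : A} (hh : 2 * h = 1) {a : ℕ} (ha : a ∈ S)
    (h0 : 0 ∈ S) (h1 : 1 ∈ S) (h2 : 2 ∈ S) :
    π ^ 3 ∣ F a - (F 0 + a * (F 1 - F 0) + h * (a * (a - 1)) * (F 2 - 2 * F 1 + F 0)) := by
  obtain ⟨c₀, c₁, c₂, hc⟩ := hF
  obtain ⟨x, hx⟩ := hc a ha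
  obtain ⟨y, hy⟩ := hc 0 h0
  obtain ⟨z, hz⟩ := hc 1 h1
  obtain ⟨w, hw⟩ := hc 2 h2
  rw [sub_eq_iff_eq_add] at hx hy hz hw
  refine ⟨x - (y + a * (z - y) + h * (a * (a - 1)) * (w - 2 * z + y)), ?_⟩
  rw [hx, hy, hz, hw]
  push_cast
  linear_combination (-π ^ 2 * a * (a - 1) * c₂) * hh

/-- The omitted Newton term is `π ^ 2 * c₂ * a(a - 1)` modulo `π ^ 3`, and the hypothesis supplies
the third factor of `π`. -/
lemma QuadMod.interpolate_linear (hF : QuadMod π S F) {a : ℕ} (ha : a ∈ S)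
    (h0 : 0 ∈ S) (h1 : 1 ∈ S) (hπ : π ∣ (a : A) * (a - 1)) :
    π ^ 3 ∣ F a - (F 0 + a * (F 1 - F 0)) := by
  obtain ⟨c₀, c₁, c₂, hc⟩ := hF
  obtain ⟨x, hx⟩ := hc a ha
  obtain ⟨y, hy⟩ := hc 0 h0
  obtain ⟨z, hz⟩ := hc 1 h1
  obtain ⟨r, hr⟩ := hπ
  rw [sub_eq_iff_eq_add] at hx hy hz
  refine ⟨x - (y + a * (z - y)) + r * c₂, ?_⟩
  rw [hx, hy, hz]
  push_cast
  linear_combination (π ^ 2 * c₂) * hr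

lemma QuadMod.dvd_sub (hF : QuadMod π S F) {a b : ℕ} (ha : a ∈ S) (hb : b ∈ S) :
    π ∣ F a - F b := by
  obtain ⟨c₀, c₁, c₂, hc⟩ := hF
  obtain ⟨x, hx⟩ := hc a ha
  obtain ⟨y, hy⟩ := hc b hb
  rw [sub_eq_iff_eq_add] at hx hy
  rw [hx, hy]
  exact ⟨π ^ 2 * (x - y) + (a - b) * c₁ + π * (a ^ 2 - b ^ 2) * c₂, by ring⟩

end QuadMod

lemma QuadMod.of_coeff {p : ℕ} [Fact p.Prime] {S : Set ℕ} {F : ℕ → PowerSeries (pInt p)}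
    (hF : ∀ n, QuadMod (p : pInt p) S fun a => PowerSeries.coeff n (F a)) :
    QuadMod (p : PowerSeries (pInt p)) S F := by
  choose c₀ c₁ c₂ hc using hF
  refine ⟨PowerSeries.mk c₀, PowerSeries.mk c₁, PowerSeries.mk c₂, fun a ha => ?_⟩
  rw [natCast_pow_dvd_iff]
  intro n
  have e1 : ((p : PowerSeries (pInt p)) * a) * PowerSeries.mk c₁ =
      PowerSeries.C ((p : pInt p) * a) * PowerSeries.mk c₁ := by simp
  have e2 : ((p : PowerSeries (pInt p)) * a) ^ 2 * PowerSeries.mk c₂ =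
      PowerSeries.C (((p : pInt p) * a) ^ 2) * PowerSeries.mk c₂ := by simp
  rw [e1, e2]
  simpa only [map_sub, map_add, PowerSeries.coeff_C_mul, PowerSeries.coeff_mk] using hc n a ha

/-! ### Voronoi's congruence and Kummer's congruences modulo `p ^ 3`. -/

section Voronoi

lemma image_mul_mod_range {a N : ℕ} (hN : 0 < N) (ha : a.Coprime N) :
    (Finset.range N).image (fun j => j * a % N) = Finset.range N := by
  apply Finset.eq_of_subset_of_card_le
  · intro x hx
    obtain ⟨j, -, rfl⟩ := Finset.mem_image.mp hx
    exact Finset.mem_range.mpr (Nat.mod_lt _ hN)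
  · rw [Finset.card_image_of_injOn]
    intro i hi j hj hij
    have h : i * a ≡ j * a [MOD N] := hij
    have := Nat.ModEq.cancel_right_of_coprime (Nat.coprime_comm.mp ha) h
    exact Nat.ModEq.eq_of_lt_of_lt this (by simpa using hi) (by simpa using hj)

/-- The sum appearing in Voronoi's congruence. -/
def voronoiSum (a N k : ℕ) : ℕ := ∑ j ∈ Finset.range N, (j * a / N) * (j * a) ^ k

/-- Multiplication by `a` permutes the residues modulo `N`; expand `(ja - N⌊ja/N⌋) ^ (k + 1)` to
first order in `N` and sum over `j`. -/
lemma exists_voronoi {a N : ℕ} (hN : 0 < N) (ha : a.Coprime N) (k : ℕ) :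
    ∃ z : ℤ, ((a : ℤ) ^ (k + 1) - 1) * ∑ j ∈ Finset.range N, (j : ℤ) ^ (k + 1) =
      (k + 1) * N * voronoiSum a N k + N ^ 2 * z := by
  have h1 : ∀ j : ℕ, ∃ z : ℤ, ((j * a % N : ℕ) : ℤ) ^ (k + 1) =
      (j * a) ^ (k + 1) - (k + 1) * N * ((j * a / N : ℕ) * (j * a) ^ k) + N ^ 2 * z := by
    intro j
    obtain ⟨c, hc⟩ := Polynomial.powAddExpansion ((j : ℤ) * a) (-(N * (j * a / N : ℕ))) (k + 1)
    refine ⟨c * (j * a / N : ℕ) ^ 2, ?_⟩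
    have h2 : ((j * a % N : ℕ) : ℤ) = (j : ℤ) * a + -(N * (j * a / N : ℕ)) := by
      have := Nat.mod_add_div (j * a) N
      have : ((j * a % N : ℕ) : ℤ) + N * (j * a / N : ℕ) = j * a := by exact_mod_cast this
      linarith
    rw [h2, hc, Nat.add_sub_cancel]
    push_cast
    ring
  choose z hz using h1
  refine ⟨-∑ j ∈ Finset.range N, z j, ?_⟩
  have h3 : ∑ j ∈ Finset.range N, (j : ℤ) ^ (k + 1) =
      ∑ j ∈ Finset.range N, ((j * a % N : ℕ) : ℤ) ^ (k + 1) := by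
    conv_lhs => rw [← image_mul_mod_range hN ha]
    refine Finset.sum_image (Finset.card_image_iff.mp ?_)
    rw [image_mul_mod_range hN ha]
  have h4 : ∑ j ∈ Finset.range N, (j : ℤ) ^ (k + 1) =
      a ^ (k + 1) * ∑ j ∈ Finset.range N, (j : ℤ) ^ (k + 1) -
        (k + 1) * N * voronoiSum a N k + N ^ 2 * ∑ j ∈ Finset.range N, z j := by
    conv_lhs => rw [h3]
    rw [Finset.sum_congr rfl fun j _ => hz j, Finset.sum_add_distrib, Finset.sum_sub_distrib,
      voronoiSum]
    push_cast
    rw [Finset.mul_sum, Finset.mul_sum, Finset.mul_sum]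
    congr 2
    exact Finset.sum_congr rfl fun j _ => by ring
  linear_combination -h4

/-- In Faulhaber's formula the term linear in `N` is `N B_k`, and the others contain `N ^ 2`. What
matters is that the common denominator `D` does not depend on `N`. -/
lemma exists_sum_pow_sub_mul_bernoulli (k : ℕ) :
    ∃ D : ℕ, D ≠ 0 ∧ ∀ N : ℕ, ∃ z : ℤ,
      (D : ℚ) * (∑ j ∈ Finset.range N, (j : ℚ) ^ k - N * bernoulli k) = N ^ 2 * z := by
  set f : ℕ → ℚ := fun i => bernoulli i * ((k + 1).choose i) / (k + 1) with hf
  refine ⟨∏ i ∈ Finset.range k, (f i).den, Finset.prod_ne_zero_iff.mpr fun i _ => (f i).den_ne_zero,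
    fun N => ?_⟩
  set D := ∏ i ∈ Finset.range k, (f i).den with hD
  have h1 : ∀ i ∈ Finset.range k, ∃ z : ℤ, (D : ℚ) * f i = z := fun i hi => by
    obtain ⟨c, hc⟩ := Finset.dvd_prod_of_mem (fun i => (f i).den) hi
    refine ⟨c * (f i).num, ?_⟩
    have hc' : (D : ℚ) = (f i).den * c := by exact_mod_cast hc
    have := Rat.den_mul_eq_num (f i)
    rw [hc']
    push_cast
    linear_combination (c : ℚ) * this
  choose! z hz using h1
  refine ⟨∑ i ∈ Finset.range k, z i * N ^ (k - 1 - i), ?_⟩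
  have hk : (k : ℚ) + 1 ≠ 0 := by positivity
  rw [sum_range_pow, Finset.sum_range_succ]
  have h2 : bernoulli k * ((k + 1).choose k) * (N : ℚ) ^ (k + 1 - k) / (k + 1) =
      N * bernoulli k := by
    rw [Nat.add_sub_cancel_left]
    simp
    field_simp
  rw [h2, add_sub_cancel_right, Finset.mul_sum]
  push_cast
  rw [Finset.mul_sum]
  refine Finset.sum_congr rfl fun i hi => ?_
  have hi' := Finset.mem_range.mp hi
  rw [← hz i hi, show k + 1 - i = 2 + (k - 1 - i) by omega, pow_add, hf]
  ring

variable {p : ℕ} [hp : Fact p.Prime]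

lemma exists_pow_div_mem_pInt {D : ℕ} (hD : D ≠ 0) :
    ∃ v : ℕ, ∃ w : pInt p, (p : ℚ) ^ v = D * w := by
  obtain ⟨v, u, hu, rfl⟩ := Nat.exists_eq_pow_mul_and_not_dvd hD p hp.out.ne_one
  obtain ⟨w, hw⟩ := (isUnit_natCast hu).exists_right_inv
  refine ⟨v, w, ?_⟩
  have : (u : ℚ) * w = 1 := by exact_mod_cast congrArg Subtype.val hw
  push_cast
  linear_combination (-(p : ℚ) ^ v) * this

/-- Divide Voronoi's congruence for `N = p ^ M` by `(k + 1) N`. The error is `N / (D (k + 1))` times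
an integer, and the denominator costs a power `p ^ v` independent of `M`. -/
lemma exists_bernoulli_sub_voronoiSum {a : ℕ} (ha : a.Coprime p) (k m : ℕ) :
    ∃ M₀ : ℕ, ∀ M ≥ M₀, ∃ w : pInt p,
      ((a : ℚ) ^ (k + 1) - 1) * (bernoulli (k + 1) / (k + 1)) - voronoiSum a (p ^ M) k =
        (p : ℚ) ^ m * w := by
  obtain ⟨D, hD, hD'⟩ := exists_sum_pow_sub_mul_bernoulli (k + 1)
  obtain ⟨v, w, hw⟩ := exists_pow_div_mem_pInt (p := p) (D := D * (k + 1))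
    (mul_ne_zero hD k.succ_ne_zero)
  refine ⟨m + v, fun M hM => ?_⟩
  obtain ⟨r, rfl⟩ := Nat.exists_eq_add_of_le hM
  set N := p ^ (m + v + r) with hN
  have hN0 : 0 < N := pow_pos hp.out.pos _
  obtain ⟨z, hz⟩ := hD' N
  obtain ⟨Z, hZ⟩ := exists_voronoi hN0 (Nat.Coprime.pow_right _ ha : a.Coprime N) k
  refine ⟨p ^ r * w * ((D * Z - ((a : ℤ) ^ (k + 1) - 1) * z : ℤ) : pInt p), ?_⟩
  have hZ' : ((a : ℚ) ^ (k + 1) - 1) * ∑ j ∈ Finset.range N, (j : ℚ) ^ (k + 1) =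
      (k + 1) * N * voronoiSum a N k + N ^ 2 * Z := by exact_mod_cast hZ
  have hNq : (N : ℚ) ≠ 0 := by exact_mod_cast hN0.ne'
  have hDq : (D : ℚ) ≠ 0 := by exact_mod_cast hD
  have hkq : (k : ℚ) + 1 ≠ 0 := by positivity
  have hNv : (N : ℚ) = p ^ m * p ^ r * (D * (k + 1) * w) := by
    rw [hN]
    push_cast at hw ⊢
    rw [← hw]
    ring
  have key : (D * (k + 1) * N : ℚ) * (((a : ℚ) ^ (k + 1) - 1) * (bernoulli (k + 1) / (k + 1)) -
      voronoiSum a N k) = N ^ 2 * (D * Z - ((a : ℚ) ^ (k + 1) - 1) * z) := by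
    have : (D * (k + 1) * N : ℚ) * (((a : ℚ) ^ (k + 1) - 1) * (bernoulli (k + 1) / (k + 1)) -
      voronoiSum a N k) = D * N * (((a : ℚ) ^ (k + 1) - 1) * bernoulli (k + 1)) -
        D * ((k + 1) * N * voronoiSum a N k) := by field_simp
    rw [this]
    linear_combination (D : ℚ) * hZ' - ((a : ℚ) ^ (k + 1) - 1) * hz
  have hne : (D * (k + 1) * N : ℚ) ≠ 0 := by positivity
  apply mul_left_cancel₀ hne
  rw [key]
  push_cast
  linear_combination (N : ℚ) * (D * Z - ((a : ℚ) ^ (k + 1) - 1) * z) * hNv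

/-- The part of `voronoiSum` over indices prime to `p`. -/
def voronoiSumCoprime (p a N k : ℕ) : ℕ :=
  ∑ j ∈ Finset.range N with ¬ p ∣ j, (j * a / N) * (j * a) ^ k

/-- The indices `j = p i` reproduce the sum at level `M`, because `⌊p i a / p ^ (M + 1)⌋ = ⌊i a / p
^ M⌋`. -/
lemma voronoiSum_pow_succ (a M k : ℕ) :
    voronoiSum a (p ^ (M + 1)) k =
      voronoiSumCoprime p a (p ^ (M + 1)) k + p ^ k * voronoiSum a (p ^ M) k := by
  have hp0 := hp.out.pos
  rw [voronoiSum, ← Finset.sum_filter_add_sum_filter_not _ (fun j => p ∣ j), add_comm,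
    voronoiSumCoprime]
  congr 1
  have : (Finset.range (p ^ (M + 1))).filter (fun j => p ∣ j) =
      (Finset.range (p ^ M)).image (fun j => p * j) := by
    ext j
    simp only [Finset.mem_filter, Finset.mem_range, Finset.mem_image]
    constructor
    · rintro ⟨h, i, rfl⟩
      rw [pow_succ'] at h
      exact ⟨i, Nat.lt_of_mul_lt_mul_left h, rfl⟩
    · rintro ⟨i, h, rfl⟩
      rw [pow_succ']
      exact ⟨Nat.mul_lt_mul_of_pos_left h hp0, dvd_mul_right _ _⟩
  rw [this, Finset.sum_image fun i _ j _ h => Nat.eq_of_mul_eq_mul_left hp0 h, voronoiSum,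
    Finset.mul_sum]
  refine Finset.sum_congr rfl fun j _ => ?_
  rw [pow_succ' p M, mul_assoc, Nat.mul_div_mul_left _ _ hp0]
  ring

/-- Subtracting `p ^ k` times level `M` from level `M + 1` produces the Euler factor and leaves only
bases prime to `p`, to which Fermat applies. -/
lemma exists_bernoulli_sub_voronoiSumCoprime {a : ℕ} (ha : a.Coprime p) (k m : ℕ) :
    ∃ M₀ : ℕ, ∀ M ≥ M₀, ∃ w : pInt p,
      ((a : ℚ) ^ (k + 1) - 1) * ((1 - (p : ℚ) ^ k) * bernoulli (k + 1) / (k + 1)) -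
        voronoiSumCoprime p a (p ^ (M + 1)) k = (p : ℚ) ^ m * w := by
  obtain ⟨M₀, h⟩ := exists_bernoulli_sub_voronoiSum ha k m
  refine ⟨M₀, fun M hM => ?_⟩
  obtain ⟨w, hw⟩ := h M hM
  obtain ⟨w', hw'⟩ := h (M + 1) (by omega)
  refine ⟨w' - p ^ k * w, ?_⟩
  rw [voronoiSum_pow_succ] at hw'
  push_cast at hw' ⊢
  linear_combination hw' - (p : ℚ) ^ k * hw

/-- Take the `p ^ 2`-th power of a primitive root: it is unchanged modulo `p`, and Euler's theorem
modulo `p ^ 3` applies. With this multiplier the factor `a ^ k - 1` in Voronoi's congruence is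
constant modulo `p ^ 3` as `k` varies modulo `p - 1`, and is a unit unless `p - 1 ∣ k`. -/
lemma exists_coprime_pow_eq_one (p : ℕ) [hp : Fact p.Prime] : ∃ a : ℕ, a.Coprime p ∧
    (p : ℤ) ^ 3 ∣ (a : ℤ) ^ (p - 1) - 1 ∧ ∀ k : ℕ, (p : ℤ) ∣ (a : ℤ) ^ k - 1 → p - 1 ∣ k := by
  obtain ⟨g, hg⟩ := IsCyclic.exists_generator (α := (ZMod p)ˣ)
  set b := (g : ZMod p).val with hb
  have hbg : (b : ZMod p) = g := ZMod.natCast_zmod_val _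
  have hbp : b.Coprime p := ZMod.val_coe_unit_coprime g
  refine ⟨b ^ p ^ 2, hbp.pow_left _, ?_, fun k hk => ?_⟩
  · have h := Nat.ModEq.pow_totient (hbp.pow_right 3)
    rw [Nat.totient_prime_pow hp.out (by norm_num)] at h
    have := (Nat.modEq_iff_dvd.mp h.symm)
    push_cast at this ⊢
    rwa [← pow_mul]
  · have h1 : ((((b ^ p ^ 2 : ℕ) : ℤ) ^ k - 1 : ℤ) : ZMod p) = 0 :=
      (ZMod.intCast_zmod_eq_zero_iff_dvd _ _).mpr hk
    push_cast at h1
    rw [ZMod.pow_card_pow, hbg, sub_eq_zero] at h1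
    have h2 : g ^ k = 1 := by ext; simpa using h1
    have h3 := orderOf_dvd_of_pow_eq_one h2
    rwa [orderOf_eq_card_of_forall_mem_zpowers hg, Nat.card_eq_fintype_card,
      ZMod.card_units] at h3

lemma exists_pow_sub_one_eq_one_add {n : ℕ} (hn : n.Coprime p) :
    ∃ t : pInt p, (n : pInt p) ^ (p - 1) = 1 + p * t := by
  have h := Nat.ModEq.pow_totient hn
  rw [Nat.totient_prime hp.out] at h
  obtain ⟨t, ht⟩ := Nat.modEq_iff_dvd.mp h.symm
  refine ⟨(t : pInt p), ?_⟩
  have : (((n ^ (p - 1) : ℕ) - (1 : ℕ) : ℤ) : pInt p) = ((p * t : ℤ) : pInt p) := congrArg _ ht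
  push_cast at this
  linear_combination this

lemma isUnit_two (hp2 : p ≠ 2) : IsUnit (2 : pInt p) := by
  have : ¬ p ∣ 2 := fun h => hp2 ((Nat.prime_dvd_prime_iff_eq hp.out Nat.prime_two).mp h)
  exact_mod_cast isUnit_natCast this

lemma QuadMod.natCast_pow {S : Set ℕ} (hp2 : p ≠ 2) {n : ℕ} (hn : ¬ p ∣ n) (k₀ : ℕ) :
    QuadMod (p : pInt p) S fun a => (n : pInt p) ^ (k₀ + a * (p - 1)) := by
  obtain ⟨t, ht⟩ := exists_pow_sub_one_eq_one_add
    (Nat.coprime_comm.mp ((Nat.Prime.coprime_iff_not_dvd hp.out).mpr hn))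
  have := (QuadMod.const (S := S) (π := (p : pInt p)) ((n : pInt p) ^ k₀)).mul
    (QuadMod.one_add_pow (isUnit_two hp2) t)
  simpa only [← ht, ← pow_mul, ← pow_add, mul_comm (p - 1)] using this

/-- **Kummer's congruences** modulo `p ^ 3`, together with the `p`-integrality of `B_k / k`. -/
theorem exists_quadMod_bernoulli (hp2 : p ≠ 2) {k₀ : ℕ} (hk₀ : ¬ (p - 1) ∣ k₀ + 1) (L : ℕ) :
    ∃ β : ℕ → pInt p, QuadMod (p : pInt p) {a | a ≤ L} β ∧ ∀ a ≤ L, (β a : ℚ) =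
      (1 - (p : ℚ) ^ (k₀ + a * (p - 1))) * bernoulli (k₀ + a * (p - 1) + 1) /
        ((k₀ + a * (p - 1) : ℕ) + 1) := by
  obtain ⟨b, hbp, hb3, hb1⟩ := exists_coprime_pow_eq_one p
  choose M₀ hM₀ using fun a : ℕ =>
    exists_bernoulli_sub_voronoiSumCoprime hbp (k₀ + a * (p - 1)) 3
  -- The level needed depends on the weight; a common one is chosen for the finitely many `a ≤ L`,
  -- which is why the range is bounded.
  set M := (Finset.range (L + 1)).sup M₀
  set V : ℕ → ℕ := fun a => voronoiSumCoprime p b (p ^ (M + 1)) (k₀ + a * (p - 1)) with hV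
  have h1 : ∀ a ≤ L, ∃ w : pInt p, ((b : ℚ) ^ (k₀ + a * (p - 1) + 1) - 1) *
      ((1 - (p : ℚ) ^ (k₀ + a * (p - 1))) * bernoulli (k₀ + a * (p - 1) + 1) /
        ((k₀ + a * (p - 1) : ℕ) + 1)) - V a = (p : ℚ) ^ 3 * w := fun a ha =>
    hM₀ a M (Finset.le_sup (Finset.mem_range.mpr (by omega)))
  choose! w hw using h1
  have hu : ∀ a : ℕ, IsUnit ((b : pInt p) ^ (k₀ + a * (p - 1) + 1) - 1) := fun a => by
    have := isUnit_intCast (p := p) (n := (b : ℤ) ^ (k₀ + a * (p - 1) + 1) - 1) fun h => by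
      have h2 := hb1 _ h
      rw [add_right_comm] at h2
      exact hk₀ ((Nat.dvd_add_left (dvd_mul_left _ _)).mp h2)
    simpa using this
  choose i hi using fun a => (hu a).exists_right_inv
  refine ⟨fun a => i a * (V a + p ^ 3 * w a), ?_, fun a ha => ?_⟩
  · have hVq : QuadMod (p : pInt p) {a | a ≤ L} fun a => (V a : pInt p) := by
      simp only [hV, voronoiSumCoprime]
      push_cast
      refine QuadMod.sum _ fun j hj => (QuadMod.const _).mul ?_
      have hj' : ¬ p ∣ j * b := fun h => (hp.out.dvd_mul.mp h).elim (Finset.mem_filter.mp hj).2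
        ((Nat.Prime.coprime_iff_not_dvd hp.out).mp (Nat.coprime_comm.mp hbp))
      exact_mod_cast QuadMod.natCast_pow hp2 hj' k₀
    -- The inverse `i a` may be replaced by `i 0`, since the factors they invert agree modulo `p ^
    -- 3`.
    refine ((QuadMod.const (i 0)).mul hVq).congr fun a _ => ?_
    have h3 : (p : pInt p) ^ 3 ∣ (b : pInt p) ^ (k₀ + a * (p - 1) + 1) - b ^ (k₀ + 0 * (p - 1) + 1)
        := by
      have h4 : (p : ℤ) ^ 3 ∣ ((b : ℤ) ^ (p - 1)) ^ a - 1 :=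
        hb3.trans (by simpa using sub_dvd_pow_sub_pow ((b : ℤ) ^ (p - 1)) 1 a)
      obtain ⟨c, hc⟩ := h4
      have hc' : (((b : pInt p) ^ (p - 1)) ^ a - 1) = p ^ 3 * (c : pInt p) := by
        exact_mod_cast congrArg (Int.cast (R := pInt p)) hc
      refine ⟨b ^ (k₀ + 1) * c, ?_⟩
      rw [add_right_comm, pow_add, mul_comm a, pow_mul]
      simp only [zero_mul, add_zero]
      linear_combination (b : pInt p) ^ (k₀ + 1) * hc'
    obtain ⟨c, hc⟩ := h3
    refine ⟨i a * w a - i a * i 0 * V a * c, ?_⟩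
    linear_combination (-(i a) * i 0 * V a) * hc + (-(i a) * V a) * hi 0 + i 0 * V a * hi a
  · have h2 : (((b : ℚ) ^ (k₀ + a * (p - 1) + 1) - 1)) * i a = 1 := by
      exact_mod_cast congrArg Subtype.val (hi a)
    have h3 := hw a ha
    generalize (1 - (p : ℚ) ^ (k₀ + a * (p - 1))) * bernoulli (k₀ + a * (p - 1) + 1) /
      ((k₀ + a * (p - 1) : ℕ) + 1) = x at h3 ⊢
    push_cast
    linear_combination (-(i a : ℚ)) * h3 + x * h2

end Voronoi

/-! ### Eisenstein series as a `p`-adic family, and `E_{p-1}` modulo `p ^ 2`. -/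

section EisensteinFamily

/-- The operator `f(q) ↦ f(q ^ p)` on power series. -/
def vOp {A : Type*} [Semiring A] (p : ℕ) (f : PowerSeries A) : PowerSeries A :=
  PowerSeries.mk fun n => if p ∣ n then PowerSeries.coeff (n / p) f else 0

lemma coeff_vOp {A : Type*} [Semiring A] (p : ℕ) (f : PowerSeries A) (n : ℕ) :
    PowerSeries.coeff n (vOp p f) = if p ∣ n then PowerSeries.coeff (n / p) f else 0 := by
  rw [vOp, PowerSeries.coeff_mk]

lemma sum_divisors_filter_dvd {B : Type*} [AddCommMonoid B] {p n : ℕ} (hp : 0 < p) (hn : n ≠ 0)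
    (f : ℕ → B) : ∑ d ∈ n.divisors with p ∣ d, f d =
      if p ∣ n then ∑ d ∈ (n / p).divisors, f (p * d) else 0 := by
  split_ifs with h
  · have : n.divisors.filter (fun d => p ∣ d) = (n / p).divisors.image (fun d => p * d) := by
      ext d
      obtain ⟨m, rfl⟩ := h
      rw [Nat.mul_div_cancel_left _ hp]
      simp only [Finset.mem_filter, Nat.mem_divisors, Finset.mem_image]
      constructor
      · rintro ⟨⟨h1, h2⟩, c, rfl⟩
        exact ⟨c, ⟨Nat.dvd_of_mul_dvd_mul_left hp h1, right_ne_zero_of_mul h2⟩, rfl⟩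
      · rintro ⟨c, ⟨h1, h2⟩, rfl⟩
        exact ⟨⟨Nat.mul_dvd_mul_left p h1, hn⟩, dvd_mul_right _ _⟩
    rw [this, Finset.sum_image fun i _ j _ h => Nat.eq_of_mul_eq_mul_left hp h]
  · refine Finset.sum_eq_zero fun d hd => absurd ?_ h
    rw [Finset.mem_filter, Nat.mem_divisors] at hd
    exact hd.2.trans hd.1.1

variable {p : ℕ} [hp : Fact p.Prime]

lemma coe_two : ((2 : pInt p) : ℚ) = 2 := rfl

lemma exists_toQ_eq_G (hp2 : p ≠ 2) {κ : ℕ} (hκ : κ ≠ 0) (h : ¬ (p - 1) ∣ κ + 1) :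
    ∃ g : PowerSeries (pInt p), toQ g = G (κ + 1) := by
  refine exists_toQ_eq fun n => ?_
  rw [G, PowerSeries.coeff_mk]
  split_ifs with hn
  · obtain ⟨β, -, hβ⟩ := exists_quadMod_bernoulli hp2 h 0
    have h0 := hβ 0 le_rfl
    simp only [zero_mul, add_zero] at h0
    -- The Euler factor `1 - p ^ κ` is a unit because `κ ≥ 1`, so it can be removed from `β 0`.
    obtain ⟨v, hv⟩ := (isUnit_one_add_mul (-(p : pInt p) ^ (κ - 1))).exists_right_inv
    obtain ⟨i, hi⟩ := (isUnit_two hp2).exists_right_inv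
    have hv' : (1 - (p : ℚ) ^ κ) * v = 1 := by
      have h1 := congrArg Subtype.val hv
      push_cast at h1
      have h2 : (p : ℚ) ^ κ = p * p ^ (κ - 1) := by
        rw [← pow_succ', Nat.sub_add_cancel (Nat.one_le_iff_ne_zero.mpr hκ)]
      linear_combination h1 - (v : ℚ) * h2
    have hi' : (i : ℚ) = 2⁻¹ := by
      have := congrArg Subtype.val hi
      rw [Subring.coe_mul, coe_two, Subring.coe_one] at this
      linarith
    have : -(bernoulli (κ + 1)) / (2 * (κ + 1 : ℕ)) = ((-(β 0 * v * i) : pInt p) : ℚ) := by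
      push_cast
      have hκ' : (κ : ℚ) + 1 ≠ 0 := by positivity
      rw [h0, hi']
      field_simp
      linear_combination bernoulli (κ + 1) * hv'
    rw [this]
    exact Subtype.coe_prop _
  · exact natCast_mem _ _

lemma coeff_of_toQ_eq_G {κ : ℕ} {g : PowerSeries (pInt p)} (hg : toQ g = G (κ + 1)) {n : ℕ}
    (hn : n ≠ 0) : PowerSeries.coeff n g = (σ κ n : pInt p) := by
  have := coeff_toQ g n
  rw [hg, G, PowerSeries.coeff_mk, if_neg hn] at this
  ext
  rw [← this]
  simp

/-- The `p`-stabilisation restricts each divisor sum to divisors prime to `p` and puts the Euler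
factor on the constant term; Fermat and Kummer then treat the coefficients one by one. -/
theorem quadMod_G (hp2 : p ≠ 2) {κ : ℕ} (h : ¬ (p - 1) ∣ κ + 1)
    {g : ℕ → PowerSeries (pInt p)} (hg : ∀ a, toQ (g a) = G (κ + a * (p - 1) + 1)) (L : ℕ) :
    QuadMod (p : PowerSeries (pInt p)) {a | a ≤ L}
      fun a => g a - (p : PowerSeries (pInt p)) ^ (κ + a * (p - 1)) * vOp p (g a) := by
  refine QuadMod.of_coeff fun n => ?_
  have hcoeff : ∀ a, PowerSeries.coeff n (g a - (p : PowerSeries (pInt p)) ^ (κ + a * (p - 1)) *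
      vOp p (g a)) = PowerSeries.coeff n (g a) - (p : pInt p) ^ (κ + a * (p - 1)) * PowerSeries.coeff n (vOp p (g a)) := by
    intro a
    rw [map_sub, show (p : PowerSeries (pInt p)) ^ (κ + a * (p - 1)) =
      PowerSeries.C ((p : pInt p) ^ (κ + a * (p - 1))) by simp, PowerSeries.coeff_C_mul]
  simp only [hcoeff]
  rcases eq_or_ne n 0 with rfl | hn
  · obtain ⟨β, hβ, hβ'⟩ := exists_quadMod_bernoulli hp2 h L
    obtain ⟨i, hi⟩ := (isUnit_two hp2).exists_right_inv
    refine ((QuadMod.const (-i)).mul hβ).congr fun a ha => ?_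
    have e1 : ((PowerSeries.coeff 0 (g a) : pInt p) : ℚ) =
        -(bernoulli (κ + a * (p - 1) + 1)) / (2 * (κ + a * (p - 1) + 1 : ℕ)) := by
      rw [← coeff_toQ, hg, G, PowerSeries.coeff_mk, if_pos rfl]
    have : PowerSeries.coeff 0 (g a) - p ^ (κ + a * (p - 1)) *
        PowerSeries.coeff 0 (vOp p (g a)) = -i * β a := by
      rw [coeff_vOp, if_pos (dvd_zero _), Nat.zero_div]
      ext
      have hi' : (i : ℚ) = 2⁻¹ := by
        have := congrArg Subtype.val hi
        rw [Subring.coe_mul, coe_two, Subring.coe_one] at this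
        linarith
      rw [AddSubgroupClass.coe_sub, Subring.coe_mul, Subring.coe_mul, Subring.coe_neg, hβ' a ha, e1, hi']
      have : ((κ + a * (p - 1) : ℕ) : ℚ) + 1 ≠ 0 := by positivity
      rw [Nat.cast_add_one (κ + a * (p - 1))]
      push_cast
      field_simp
      ring
    rw [this, sub_self]
    exact dvd_zero _
  · have : ∀ a, PowerSeries.coeff n (g a) - p ^ (κ + a * (p - 1)) *
        PowerSeries.coeff n (vOp p (g a)) =
        ∑ d ∈ n.divisors with ¬ p ∣ d, (d : pInt p) ^ (κ + a * (p - 1)) := by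
      intro a
      rw [coeff_of_toQ_eq_G (hg a) hn, sub_eq_iff_eq_add, ArithmeticFunction.sigma_apply,
        Nat.cast_sum, ← Finset.sum_filter_add_sum_filter_not _ (fun d => p ∣ d), add_comm]
      congr 1
      · simp
      · rw [sum_divisors_filter_dvd hp.out.pos hn, coeff_vOp]
        split_ifs with hpn
        · rw [coeff_of_toQ_eq_G (hg a) (Nat.div_pos (Nat.le_of_dvd (Nat.pos_of_ne_zero hn) hpn)
            hp.out.pos).ne', ArithmeticFunction.sigma_apply, Nat.cast_sum, Finset.mul_sum]
          exact Finset.sum_congr rfl fun d _ => by push_cast; ring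
        · simp
    simp only [this]
    exact QuadMod.sum _ fun d hd => QuadMod.natCast_pow hp2 (Finset.mem_filter.mp hd).2 κ

/-- By von Staudt–Clausen, `B_{p-1} + 1/p` is `p`-integral: every other prime in the sum has a
`p`-integral inverse. -/
lemma exists_mul_bernoulli_sub_one (hp2 : p ≠ 2) :
    ∃ t : pInt p, (p : ℚ) * bernoulli (p - 1) = -1 + p * t := by
  have hp0 := hp.out.pos
  obtain ⟨m, hm⟩ := hp.out.even_sub_one hp2
  have hm2 : 2 * m = p - 1 := by omega
  obtain ⟨z, hz⟩ := Bernoulli.vonStaudt_clausen m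
  have hmem : p ∈ (Finset.range (2 * m + 2)).filter (fun q => q.Prime ∧ (q - 1) ∣ 2 * m) := by
    rw [Finset.mem_filter, Finset.mem_range, hm2]
    exact ⟨by omega, hp.out, dvd_rfl⟩
  rw [← Finset.add_sum_erase _ _ hmem, hm2] at hz
  set s := ∑ q ∈ ((Finset.range (p - 1 + 2)).filter
    (fun q => q.Prime ∧ (q - 1) ∣ p - 1)).erase p, (1 : ℚ) / q with hs
  have hs' : s ∈ pInt p := by
    refine sum_mem fun q hq => ?_
    rw [Finset.mem_erase, Finset.mem_filter] at hq
    obtain ⟨v, hv⟩ := (isUnit_natCast (p := p) (n := q) fun h =>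
      hq.1 ((Nat.prime_dvd_prime_iff_eq hp.out hq.2.2.1).mp h).symm).exists_right_inv
    have hv' : (q : ℚ) * v = 1 := by exact_mod_cast congrArg Subtype.val hv
    have : (1 : ℚ) / q = v := by
      have : (q : ℚ) ≠ 0 := by exact_mod_cast hq.2.2.1.ne_zero
      field_simp
      rw [← hv']
    rw [this]
    exact v.2
  refine ⟨z - ⟨s, hs'⟩, ?_⟩
  have : (p : ℚ) ≠ 0 := by exact_mod_cast hp0.ne'
  push_cast
  rw [hz]
  field_simp
  ring

/-- Write `n σ_{p-2}(n) = ∑ (n/d) d ^ (p - 1)`; modulo `p`, Fermat keeps exactly the terms `n/d`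
with `p ∤ d`. -/
lemma dvd_mul_sigma_sub (hp3 : 3 ≤ p) {n : ℕ} (hn : n ≠ 0) :
    (p : ℤ) ∣ n * σ (p - 2) n - (σ 1 n - if p ∣ n then (σ 1 (n / p) : ℤ) else 0) := by
  have h1 : (n * σ (p - 2) n : ℤ) = ∑ d ∈ n.divisors, ((n / d : ℕ) : ℤ) * d ^ (p - 1) := by
    rw [ArithmeticFunction.sigma_apply, Nat.cast_sum, Finset.mul_sum]
    refine Finset.sum_congr rfl fun d hd => ?_
    obtain ⟨c, rfl⟩ := Nat.dvd_of_mem_divisors hd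
    have hd0 : 0 < d := Nat.pos_of_ne_zero (left_ne_zero_of_mul hn)
    rw [Nat.mul_div_cancel_left _ hd0, show p - 1 = p - 2 + 1 by omega]
    push_cast
    ring
  have h2 : (σ 1 n : ℤ) = ∑ d ∈ n.divisors, ((n / d : ℕ) : ℤ) := by
    rw [ArithmeticFunction.sigma_one_apply, ← Nat.sum_div_divisors n fun d => d]
    push_cast
    rfl
  have h3 : (if p ∣ n then (σ 1 (n / p) : ℤ) else 0) =
      ∑ d ∈ n.divisors with p ∣ d, ((n / d : ℕ) : ℤ) := by
    rw [sum_divisors_filter_dvd hp.out.pos hn]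
    split_ifs
    · rw [ArithmeticFunction.sigma_one_apply, ← Nat.sum_div_divisors (n / p) fun d => d]
      simp only [Nat.cast_sum, Nat.div_div_eq_div_mul]
    · rfl
  rw [h1, h2, h3, Finset.sum_filter, ← Finset.sum_sub_distrib, ← Finset.sum_sub_distrib]
  refine Finset.dvd_sum fun d _ => ?_
  split_ifs with hd
  · rw [sub_self, sub_zero]
    exact ((Int.natCast_dvd_natCast.mpr hd).trans (dvd_pow_self _ (by omega))).mul_left _
  · rw [sub_zero]
    have h := Nat.ModEq.pow_totient
      (Nat.coprime_comm.mp ((Nat.Prime.coprime_iff_not_dvd hp.out).mpr hd))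
    rw [Nat.totient_prime hp.out] at h
    have h' := Nat.modEq_iff_dvd.mp h.symm
    push_cast at h'
    convert! h'.mul_left ((n / d : ℕ) : ℤ) using 1
    push_cast
    ring

/-- The coefficient `-2(p - 1)/B_{p-1}` equals `p c` with `c ≡ -2` modulo `p`, so `q d/dq` of `x` is
governed by `n σ_{p-2}(n)`, that is, by `G_2(q) - G_2(q ^ p)`. -/
theorem exists_toQ_eq_E (hp5 : 5 ≤ p) {g : PowerSeries (pInt p)} (hg : toQ g = G 2) :
    ∃ e x : PowerSeries (pInt p), toQ e = E (p - 1) ∧ e = 1 + p * x ∧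
      (p : PowerSeries (pInt p)) ∣ qDeriv x + 2 * (g - vOp p g) := by
  have hp2 : p ≠ 2 := by omega
  obtain ⟨t, ht⟩ := exists_mul_bernoulli_sub_one hp2
  obtain ⟨v, hv⟩ := (isUnit_one_add_mul (-t)).exists_right_inv
  have hv' : (1 + (p : ℚ) * -t) * v = 1 := by exact_mod_cast congrArg Subtype.val hv
  have hB : bernoulli (p - 1) ≠ 0 :=
    bernoulli_ne_zero_of_even (hp.out.even_sub_one hp2) (by omega)
  set c : pInt p := 2 * ((p - 1 : ℕ) : pInt p) * v with hc
  have hcB : -(2 * ((p - 1 : ℕ) : ℚ)) / bernoulli (p - 1) = p * c := by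
    rw [div_eq_iff hB, hc, Subring.coe_mul, Subring.coe_mul, coe_two, Subring.coe_natCast]
    linear_combination (2 * ((p - 1 : ℕ) : ℚ)) * hv' - (2 * ((p - 1 : ℕ) : ℚ) * v) * ht
  set x : PowerSeries (pInt p) :=
    PowerSeries.mk fun n => if n = 0 then 0 else c * σ (p - 2) n with hx
  refine ⟨1 + p * x, x, ?_, rfl, ?_⟩
  · ext n
    rw [E, if_neg (by omega), PowerSeries.coeff_C_mul, G, PowerSeries.coeff_mk, map_add, map_one,
      map_mul, map_natCast, map_add, PowerSeries.coeff_one,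
      show (p : PowerSeries ℚ) = PowerSeries.C (p : ℚ) by simp, PowerSeries.coeff_C_mul, coeff_toQ,
      hx, PowerSeries.coeff_mk]
    split_ifs with hn
    · have : ((p - 1 : ℕ) : ℚ) ≠ 0 := by exact_mod_cast (by omega : p - 1 ≠ 0)
      simp only [ZeroMemClass.coe_zero, mul_zero, add_zero]
      field_simp
    · rw [hcB, show p - 1 - 1 = p - 2 by omega]
      push_cast
      ring
  · have : (p : PowerSeries (pInt p)) ^ 1 ∣ qDeriv x + 2 * (g - vOp p g) := by
      rw [natCast_pow_dvd_iff]
      intro n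
      rw [map_add, coeff_qDeriv, two_mul, map_add, map_sub, coeff_vOp, hx, PowerSeries.coeff_mk,
        pow_one]
      rcases eq_or_ne n 0 with rfl | hn
      · simp
      · rw [if_neg hn, coeff_of_toQ_eq_G (κ := 1) hg hn]
        obtain ⟨z, hz⟩ := dvd_mul_sigma_sub (p := p) (by omega) hn
        have hz' : (n * σ (p - 2) n : pInt p) - (σ 1 n - if p ∣ n then (σ 1 (n / p) : pInt p)
            else 0) = p * z := by
          have := congrArg (Int.cast (R := pInt p)) hz
          push_cast at this
          exact this
        have hif : (if p ∣ n then PowerSeries.coeff (n / p) g else 0) =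
            if p ∣ n then (σ 1 (n / p) : pInt p) else 0 := by
          split_ifs with hpn
          · exact coeff_of_toQ_eq_G (κ := 1) hg
              (Nat.div_pos (Nat.le_of_dvd (Nat.pos_of_ne_zero hn) hpn) hp.out.pos).ne'
          · rfl
        rw [hif]
        generalize (if p ∣ n then (σ 1 (n / p) : pInt p) else 0) = y at hz' ⊢
        have hp1 : ((p - 1 : ℕ) : pInt p) = p - 1 := by
          rw [Nat.cast_sub hp.out.one_le, Nat.cast_one]
        refine ⟨c * z + 2 * v * (1 - t) * (σ 1 n - y), ?_⟩
        rw [hc, hp1]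
        linear_combination (2 * ((p : pInt p) - 1) * v) * hz' - 2 * ((σ 1 n : pInt p) - y) * hv
    simpa using this

end EisensteinFamily

/-! ### Interpolation and the bounds on the filtration. -/

section Filtration

/-- Only `e ^ j * l` will be modular, so `e ^ (a - j)` is wanted even for `a < j`; because `e ^ N ≡
1`, the exponent may be raised by `j N` to stay nonnegative. -/
lemma dvd_sub_pow_add_mul {A : Type*} [CommRing A] {d e f h l : A} {a N : ℕ} (j : ℕ) (hN : N ≠ 0)
    (he : d ∣ e ^ N - 1) (hf : f = e ^ a * h) (hl : d ∣ h - l) :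
    d ∣ f - e ^ (a + j * (N - 1)) * (e ^ j * l) := by
  have h1 : d ∣ (e ^ N) ^ j - 1 := he.trans (by simpa using sub_dvd_pow_sub_pow (e ^ N) 1 j)
  have h2 : e ^ (a + j * (N - 1)) * (e ^ j * l) = e ^ a * ((e ^ N) ^ j * l) := by
    obtain ⟨M, rfl⟩ := Nat.exists_eq_succ_of_ne_zero hN
    rw [Nat.succ_eq_add_one, Nat.add_sub_cancel]
    ring
  rw [h2, hf]
  have h3 : e ^ a * h - e ^ a * ((e ^ N) ^ j * l) =
      e ^ a * ((h - l) - ((e ^ N) ^ j - 1) * l) := by ring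
  rw [h3]
  exact (dvd_sub hl (h1.mul_right l)).mul_left _

lemma IsModular.of_weight_eq {k l : ℕ} {f : PowerSeries ℚ} (hf : IsModular k f) (h : k = l) :
    IsModular l f := h ▸ hf

lemma not_sub_one_dvd_add {p κ : ℕ} (h : ¬ (p - 1) ∣ κ + 1) (a : ℕ) :
    ¬ (p - 1) ∣ κ + a * (p - 1) + 1 := by
  rw [add_right_comm]
  exact fun h' => h ((Nat.dvd_add_left (dvd_mul_left _ _)).mp h')

variable {p : ℕ} [hp : Fact p.Prime]

lemma pow_three_dvd_pow_sq_sub_one {e x : PowerSeries (pInt p)} (he : e = 1 + p * x) :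
    (p : PowerSeries (pInt p)) ^ 3 ∣ e ^ p ^ 2 - 1 := by
  have := dvd_sub_pow_of_dvd_sub (R := PowerSeries (pInt p)) (p := p) (a := e) (b := 1)
    ⟨x, by rw [he]; ring⟩ 2
  simpa using this

lemma exists_inverse_eq_one_add {e x : PowerSeries (pInt p)} (he : e = 1 + p * x) :
    ∃ u y : PowerSeries (pInt p), e * u = 1 ∧ u = 1 + p * y := by
  have : IsUnit e := by
    rw [PowerSeries.isUnit_iff_constantCoeff, he]
    simpa using isUnit_one_add_mul (PowerSeries.constantCoeff x)
  obtain ⟨u, hu⟩ := this.exists_right_inv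
  refine ⟨u, -x * u, hu, ?_⟩
  rw [he] at hu
  linear_combination hu

lemma C_two : PowerSeries.C (2 : pInt p) = 2 := map_ofNat _ 2

lemma isUnit_two_powerSeries (hp2 : p ≠ 2) : IsUnit (2 : PowerSeries (pInt p)) := by
  simpa only [C_two] using (isUnit_two hp2).map (PowerSeries.C (R := pInt p))

lemma QuadMod.mul_inverse_pow {S : Set ℕ} (hp2 : p ≠ 2) {F : ℕ → PowerSeries (pInt p)}
    (hF : QuadMod (p : PowerSeries (pInt p)) S F) {u y : PowerSeries (pInt p)}
    (hu : u = 1 + p * y) : QuadMod (p : PowerSeries (pInt p)) S fun a => F a * u ^ a := by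
  have := hF.mul (QuadMod.one_add_pow (S := S) (isUnit_two_powerSeries hp2) y)
  simpa only [← hu] using this

theorem factorFiltration_G_le (hp5 : 5 ≤ p) {κ : ℕ} (hκ : 3 ≤ κ) (heven : Even (κ + 1))
    (h : ¬ (p - 1) ∣ κ + 1) (a : ℕ) :
    factorFiltration p 3 (G (κ + a * (p - 1) + 1)) ≤ (2 * (p - 1) + (κ + 1) : ℕ) ∧
      ((p : ℤ) ∣ a * (a - 1) →
        factorFiltration p 3 (G (κ + a * (p - 1) + 1)) ≤ ((p - 1) + (κ + 1) : ℕ)) := by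
  have hp2 : p ≠ 2 := by omega
  have hpe : Even (p - 1) := hp.out.even_sub_one hp2
  obtain ⟨g₂, hg₂⟩ := exists_toQ_eq_G hp2 one_ne_zero (κ := 1)
    fun h => absurd (Nat.le_of_dvd (by norm_num) h) (by omega)
  obtain ⟨e, x, heE, hex, -⟩ := exists_toQ_eq_E hp5 hg₂
  obtain ⟨u, y, heu, huy⟩ := exists_inverse_eq_one_add hex
  choose g hg using fun a : ℕ =>
    exists_toQ_eq_G hp2 (κ := κ + a * (p - 1)) (by omega) (not_sub_one_dvd_add h a)
  have hmod : ∀ a, IsModular (κ + a * (p - 1) + 1) (toQ (g a)) := fun a => by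
    rw [hg]
    refine isModular_G ?_ (by omega)
    rw [add_right_comm]
    exact heven.add (hpe.mul_left a)
  have hmodE : IsModular (p - 1) (toQ e) := heE ▸ isModular_E hpe (by omega)
  have hN : p ^ 2 ≠ 0 := pow_ne_zero 2 hp.out.ne_zero
  have hN1 := pow_three_dvd_pow_sq_sub_one hex
  -- The bound `a + 2` makes the range contain both `a` and the nodes 0, 1, 2. The stabilising term
  -- vanishes modulo `p ^ 3` because `κ ≥ 3`.
  have hquad : QuadMod (p : PowerSeries (pInt p)) {b | b ≤ a + 2} g :=
    (quadMod_G hp2 h hg (a + 2)).congr fun b _ => by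
      rw [sub_sub_cancel]
      exact (pow_dvd_pow _ (by omega)).mul_right _
  have hH := hquad.mul_inverse_pow hp2 huy
  have hga : g a = e ^ a * (g a * u ^ a) := by
    rw [mul_left_comm, ← mul_pow, heu, one_pow, mul_one]
  rw [← hg a]
  constructor
  · obtain ⟨i, hi⟩ := (isUnit_two hp2).exists_right_inv
    have hi' : (2 : PowerSeries (pInt p)) * PowerSeries.C i = 1 := by
      simpa only [map_mul, C_two, map_one] using congrArg (PowerSeries.C (R := pInt p)) hi
    have key := hH.interpolate hi' (a := a) (by simp) (by simp) (by simp) (by simp)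
    refine factorFiltration_toQ_le heE ?_ (dvd_sub_pow_add_mul 2 hN hN1 hga key)
    -- Multiplying by `e ^ 2` clears the inverses `u` and brings the three nodes to the common
    -- weight `2(p - 1) + κ + 1`.
    have : e ^ 2 * (g 0 * u ^ 0 + a * (g 1 * u ^ 1 - g 0 * u ^ 0) + PowerSeries.C i *
        (a * (a - 1)) * (g 2 * u ^ 2 - 2 * (g 1 * u ^ 1) + g 0 * u ^ 0)) =
        PowerSeries.C (1 - (a : pInt p) + i * (a * (a - 1))) * (e * (e * g 0)) +
        PowerSeries.C ((a : pInt p) - 2 * i * (a * (a - 1))) * (e * g 1) +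
        PowerSeries.C (i * ((a : pInt p) * (a - 1))) * g 2 := by
      simp only [map_sub, map_add, map_mul, map_natCast, map_one, map_ofNat]
      linear_combination (a * e * g 1 - 2 * PowerSeries.C i * (a * (a - 1)) * e * g 1 +
        PowerSeries.C i * (a * (a - 1)) * g 2 * (e * u + 1)) * heu
    rw [this, map_add, map_add]
    refine ((IsModular.C_mul_toQ ?_ _).add (IsModular.C_mul_toQ ?_ _)).add
      (IsModular.C_mul_toQ ?_ _)
    · rw [map_mul, map_mul]
      exact (hmodE.mul (hmodE.mul (hmod 0))).of_weight_eq (by ring)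
    · rw [map_mul]
      exact (hmodE.mul (hmod 1)).of_weight_eq (by ring)
    · exact (hmod 2).of_weight_eq (by ring)
  · intro hpa
    have hpa' : (p : PowerSeries (pInt p)) ∣ a * (a - 1) := by
      obtain ⟨c, hc⟩ := hpa
      exact ⟨(c : PowerSeries (pInt p)), by
        exact_mod_cast congrArg (Int.cast (R := PowerSeries (pInt p))) hc⟩
    have key := hH.interpolate_linear (a := a) (by simp) (by simp) (by simp) hpa'
    refine factorFiltration_toQ_le heE ?_ (dvd_sub_pow_add_mul 1 hN hN1 hga key)
    have : e ^ 1 * (g 0 * u ^ 0 + a * (g 1 * u ^ 1 - g 0 * u ^ 0)) =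
        PowerSeries.C (1 - (a : pInt p)) * (e * g 0) + PowerSeries.C (a : pInt p) * g 1 := by
      simp only [map_sub, map_natCast, map_one]
      linear_combination (a * g 1) * heu
    rw [this, map_add]
    refine (IsModular.C_mul_toQ ?_ _).add (IsModular.C_mul_toQ ?_ _)
    · rw [map_mul]
      exact (hmodE.mul (hmod 0)).of_weight_eq (by ring)
    · exact (hmod 1).of_weight_eq (by ring)

/-- The weight two Eisenstein series, once `p`-stabilised, is congruent modulo `p ^ 2` to a
form of weight `p + 1` divided by `E_{p-1}`. -/
lemma exists_isModular_mul_G_two (hp5 : 5 ≤ p) {e x g₂ g₁ : PowerSeries (pInt p)}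
    (heE : toQ e = E (p - 1)) (hex : e = 1 + p * x) (hg₂ : toQ g₂ = G 2)
    (hx : (p : PowerSeries (pInt p)) ∣ qDeriv x + 2 * (g₂ - vOp p g₂))
    (hg₁ : IsModular (p + 1) (toQ g₁)) (h1 : (p : PowerSeries (pInt p)) ∣ g₁ - g₂) :
    ∃ w : PowerSeries (pInt p), IsModular (p + 1) (toQ w) ∧
      (p : PowerSeries (pInt p)) ^ 2 ∣ e * (g₂ - p * vOp p g₂) - w := by
  have hp2 : p ≠ 2 := by omega
  have hpe : Even (p - 1) := hp.out.even_sub_one hp2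
  have hmodE : IsModular (p - 1) (toQ e) := heE ▸ isModular_E hpe (by omega)
  have hunit : IsUnit (2 * ((p - 1 : ℕ) : pInt p)) :=
    (isUnit_two hp2).mul (isUnit_natCast fun h =>
      absurd (Nat.le_of_dvd (by omega) h) (by omega))
  obtain ⟨s, hs⟩ := hunit.exists_right_inv
  have hp1 : ((p - 1 : ℕ) : PowerSeries (pInt p)) = p - 1 := by
    rw [Nat.cast_sub hp.out.one_le, Nat.cast_one]
  have hs' : 2 * ((p : PowerSeries (pInt p)) - 1) * PowerSeries.C s = 1 := by
    rw [← hp1]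
    simpa only [map_mul, C_two, map_one, map_natCast] using
      congrArg (PowerSeries.C (R := pInt p)) hs
  -- The Serre derivative of `E_{p-1}`, of weight `p + 1`.
  set w₀ : PowerSeries (pInt p) :=
    qDeriv e + PowerSeries.C (2 * ((p - 1 : ℕ) : pInt p)) * (g₂ * e) with hw₀
  have hw₀m : IsModular (p + 1) (toQ w₀) := by
    have hq : toQ (qDeriv e) = qDeriv (toQ e) := by
      ext n
      simp
    have := hmodE.serreDerivative.of_weight_eq (show p - 1 + 2 = p + 1 by omega)
    rw [hw₀, map_add, map_mul _ (PowerSeries.C _), map_mul _ g₂, hq, hg₂, PowerSeries.map_C]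
    exact this
  have hqe : qDeriv e = p * qDeriv x := by
    ext n
    rw [hex, coeff_qDeriv, map_add, ← map_natCast (PowerSeries.C (R := pInt p)) p,
      PowerSeries.coeff_C_mul, PowerSeries.coeff_C_mul, coeff_qDeriv, PowerSeries.coeff_one]
    split_ifs with hn
    · simp [hn]
    · rw [zero_add, mul_left_comm]
  -- Here `s = 1/(2(p - 1)) ≡ -1/2` modulo `p`. With `V` the map `q ↦ q ^ p`, this gives `s w₀ ≡ e
  -- G_2 + p(G_2 - V G_2)` modulo `p ^ 2`. Subtracting `p g₁ ≡ p G_2` leaves `e G_2 - p V G_2 ≡ e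
  -- (G_2 - p V G_2)`, as `e ≡ 1` modulo `p`.
  refine ⟨PowerSeries.C s * w₀ + PowerSeries.C (-(p : pInt p)) * g₁, ?_, ?_⟩
  · rw [map_add]
    exact (hw₀m.C_mul_toQ s).add (hg₁.C_mul_toQ _)
  · obtain ⟨r, hr⟩ := hx
    obtain ⟨r', hr'⟩ := h1
    rw [hw₀, hqe]
    simp only [map_mul, map_natCast, map_neg, hp1, map_ofNat]
    rw [sub_eq_iff_eq_add] at hr'
    have hr2 : qDeriv x = p * r - 2 * (g₂ - vOp p g₂) := by linear_combination hr
    refine ⟨-x * vOp p g₂ - PowerSeries.C s * r + 2 * PowerSeries.C s * (g₂ - vOp p g₂) + r', ?_⟩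
    rw [hr2, hr', hex]
    linear_combination (-(1 + p * x) * g₂ - p * (g₂ - vOp p g₂)) * hs'

theorem factorFiltration_G_le_of_modEq_one (hp5 : 5 ≤ p) {a : ℕ} (ha : 1 ≤ a)
    (hpa : (p : ℤ) ∣ a - 1) :
    factorFiltration p 3 (G (1 + a * (p - 1) + 1)) ≤ ((p - 1) + 2 : ℕ) := by
  have hp2 : p ≠ 2 := by omega
  have hpe : Even (p - 1) := hp.out.even_sub_one hp2
  have h : ¬ (p - 1) ∣ 1 + 1 := fun h => absurd (Nat.le_of_dvd (by norm_num) h) (by omega)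
  choose g hg using fun a : ℕ =>
    exists_toQ_eq_G hp2 (κ := 1 + a * (p - 1)) (by omega) (not_sub_one_dvd_add h a)
  have hg0 : toQ (g 0) = G 2 := by simpa using hg 0
  obtain ⟨e, x, heE, hex, hx⟩ := exists_toQ_eq_E hp5 hg0
  obtain ⟨u, y, heu, huy⟩ := exists_inverse_eq_one_add hex
  have hmod1 : IsModular (p + 1) (toQ (g 1)) := by
    rw [hg, show 1 + 1 * (p - 1) + 1 = p + 1 by omega]
    refine isModular_G ?_ (by omega)
    rw [show p + 1 = p - 1 + 2 by omega]
    exact hpe.add even_two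
  -- Only weight 2 needs its stabilising term: for `b ≥ 1` that term carries at least `p ^ p`.
  set F : ℕ → PowerSeries (pInt p) := fun b => if b = 0 then g 0 - p * vOp p (g 0) else g b with hF
  have hquad : QuadMod (p : PowerSeries (pInt p)) {b | b ≤ a} F :=
    (quadMod_G hp2 h hg a).congr fun b _ => by
      rcases eq_or_ne b 0 with rfl | hb
      · simp [hF]
      · simp only [hF, if_neg hb]
        rw [sub_sub_cancel]
        have : 1 * (p - 1) ≤ b * (p - 1) :=
          Nat.mul_le_mul_right _ (Nat.one_le_iff_ne_zero.mpr hb)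
        exact (pow_dvd_pow _ (by omega)).mul_right _
  have hF0 : F 0 = g 0 - p * vOp p (g 0) := if_pos rfl
  have hF1 : F 1 = g 1 := if_neg one_ne_zero
  have hFa : F a = g a := if_neg (by omega)
  have h10 : (p : PowerSeries (pInt p)) ∣ g 1 - g 0 := by
    have := dvd_sub (hquad.dvd_sub (a := 1) (b := 0) ha (Nat.zero_le a))
      (dvd_mul_right _ (vOp p (g 0)))
    rw [hF0, hF1] at this
    convert! this using 1
    abel
  obtain ⟨w, hw, c, hc⟩ := exists_isModular_mul_G_two hp5 heE hex hg0 hx hmod1 h10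
  obtain ⟨r, hr⟩ := hpa
  have hr' : (a : PowerSeries (pInt p)) - 1 = p * r := by
    exact_mod_cast congrArg (Int.cast (R := PowerSeries (pInt p))) hr
  have hH := hquad.mul_inverse_pow hp2 huy
  have hHa := hH.interpolate_linear (a := a) (show a ≤ a from le_rfl) (Nat.zero_le a) ha
    ⟨a * r, by rw [hr']; ring⟩
  -- Replacing `e * F 0` by `w` is legitimate only modulo `p ^ 2`; the coefficient `1 - a` provides
  -- the remaining factor `p`.
  have key : (p : PowerSeries (pInt p)) ^ 3 ∣
      F a * u ^ a - u * ((1 - a) * w + a * g 1) := by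
    convert! dvd_sub hHa (dvd_mul_right ((p : PowerSeries (pInt p)) ^ 3) (r * u * c)) using 1
    rw [hF1, hF0]
    linear_combination (-(p : PowerSeries (pInt p)) * r * u) * hc -
      u * (e * (g 0 - p * vOp p (g 0)) - w) * hr' + (a - 1) * (g 0 - p * vOp p (g 0)) * heu
  rw [hFa] at key
  have hga : g a = e ^ a * (g a * u ^ a) := by
    rw [mul_left_comm, ← mul_pow, heu, one_pow, mul_one]
  rw [← hg a]
  refine factorFiltration_toQ_le heE ?_ (dvd_sub_pow_add_mul 1 (pow_ne_zero 2 hp.out.ne_zero)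
    (pow_three_dvd_pow_sq_sub_one hex) hga key)
  have : e ^ 1 * (u * ((1 - a) * w + a * g 1)) =
      PowerSeries.C (1 - (a : pInt p)) * w + PowerSeries.C (a : pInt p) * g 1 := by
    simp only [map_sub, map_natCast, map_one]
    linear_combination ((1 - a) * w + a * g 1) * heu
  rw [this, map_add]
  exact ((hw.C_mul_toQ _).add (hmod1.C_mul_toQ _)).of_weight_eq (by omega)

end Filtration

end EisensteinFiltration
end

/-! ### Assembly of the cases. -/

theorem corollary5p1 (p : ℕ) (hp : p.Prime) (hp5 : 5 ≤ p) (k α k₀ : ℕ)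
    (hk : k = α * (p - 1) + k₀) (hk_even : Even k) (hk4 : 4 ≤ k)
    (hk₀ : 2 ≤ k₀) (hk₀p : k₀ ≤ p - 3) :
    (4 ≤ k₀ →
      EisensteinFiltration.factorFiltration p 3 (EisensteinFiltration.G k) ≤
        ((if α ≡ 0 [MOD p] ∨ α ≡ 1 [MOD p] then (p - 1) + k₀
          else 2 * (p - 1) + k₀ : ℕ) : ℕ∞)) ∧
    (k₀ = 2 →
      EisensteinFiltration.factorFiltration p 3 (EisensteinFiltration.G k) ≤
        ((if α ≡ 1 [MOD p] then (p - 1) + 2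
          else if α ≡ 2 [MOD p] then 2 * (p - 1) + 2
          else 3 * (p - 1) + 2 : ℕ) : ℕ∞)) := by
  have : Fact p.Prime := ⟨hp⟩
  have hpe : Even (p - 1) := hp.even_sub_one (by omega)
  have hmod : ∀ c, α ≡ c [MOD p] → (p : ℤ) ∣ α - c := fun c hc =>
    Nat.modEq_iff_dvd.mp hc.symm
  constructor
  · intro h4
    obtain ⟨κ, rfl⟩ : ∃ κ, k₀ = κ + 1 := ⟨k₀ - 1, by omega⟩
    have hk' : k = κ + α * (p - 1) + 1 := by omega
    have heven : Even (κ + 1) := by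
      rw [hk] at hk_even
      exact (Nat.even_add.mp hk_even).mp (hpe.mul_left α)
    have hnd : ¬ (p - 1) ∣ κ + 1 := fun h => absurd (Nat.le_of_dvd (by omega) h) (by omega)
    obtain ⟨h1, h2⟩ := EisensteinFiltration.factorFiltration_G_le hp5 (by omega) heven hnd α
    rw [hk']
    split_ifs with h
    · refine h2 (h.elim (fun h => ?_) fun h => ?_)
      · simpa using (hmod 0 h).mul_right ((α : ℤ) - 1)
      · simpa using (hmod 1 h).mul_left (α : ℤ)
    · exact h1
  · rintro rfl
    -- The value `α = 0` would give `k = 2`, against `4 ≤ k`.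
    obtain ⟨b, rfl⟩ : ∃ b, α = b + 1 := ⟨α - 1, by
      rcases Nat.eq_zero_or_pos α with rfl | h <;> omega⟩
    split_ifs with h h'
    · have hk' : k = 1 + (b + 1) * (p - 1) + 1 := by omega
      rw [hk']
      exact EisensteinFiltration.factorFiltration_G_le_of_modEq_one hp5 (by omega) (hmod 1 h)
    -- The family is restarted at weight `p + 1` with index `b = α - 1`. Then `α ≡ 2` becomes `b ≡
    -- 1`, the linear case, and `j(p - 1) + (p + 1) = (j + 1)(p - 1) + 2` for `j = 1, 2`.
    all_goals
      have hk' : k = p + b * (p - 1) + 1 := by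
        rw [hk, Nat.succ_mul]
        omega
      have heven : Even (p + 1) := by
        rw [show p + 1 = p - 1 + 2 by omega]
        exact hpe.add even_two
      have hnd : ¬ (p - 1) ∣ p + 1 := fun h => by
        rw [show p + 1 = p - 1 + 2 by omega] at h
        exact absurd (Nat.le_of_dvd (by norm_num) ((Nat.dvd_add_right dvd_rfl).mp h)) (by omega)
      obtain ⟨h1, h2⟩ := EisensteinFiltration.factorFiltration_G_le hp5 (by omega) heven hnd b
      rw [hk']
    · refine (h2 ?_).trans (by exact_mod_cast (by omega))
      have := (hmod 2 h').mul_left (b : ℤ)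
      push_cast at this
      rwa [show (b : ℤ) - 1 = b + 1 - 2 by ring]
    · exact h1.trans (by exact_mod_cast (by omega))
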